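/- Setting. Let $\theta$ be a substitution of constant length $r$ over $\mathcal A=\{0,\dots,N\}$, i.e. each $\theta(a)=\theta(a)_0\cdots\theta(a)_{r-1}$ is a word of length $r$ over $\mathcal A$. Assume that $\theta$ is (i) primitive: for some $k$, every letter occurs in $\theta^k(a)$ for every letter $a$; (ii) in canonical form: $\theta(a)_0=\theta(a)_{r-1}=a$ for every letter $a$; (iii) simple (coincidence-free): $\theta(a)_n\ne\theta(b)_n$ for all letters $a\neq b$ and all $0\le n<r$; (iv) admissible: $\theta$ is injective on letters and its right-infinite fixed point $u=\lim_k\theta^k(0)$ is not periodic. For a substitution $\psi$ of constant length, let $X_\psi$ be the space of bi-infinite words all of whose finite subwords occur in some $\psi^k(a)$ ($k\ge0$, $a$ a letter), with the topology induced from the product topology, and let $\sigma$ be the shift on $X_\psi$. (For primitive $\psi$, $X_\psi$ is the orbit closure of any bi-infinite fixed point whose two central letters form a word that occurs in some $\psi^k(a)$.) Let $d_\theta=\gcd\{n\ge 1:u_n=0\}$ and let $m(\theta)$ be the product, with multiplicity, of the prime factors of $d_\theta$ that do not divide $r$. For $a\in\mathcal A$ let $z(a)$ be the position of the first letter $0$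 in the right-infinite fixed point $\lim_k\theta^k(a)$. For $p\in\mathbb Z/m(\theta)$ put $S_p=\{a\in\mathcal A: z(a)\equiv -p \bmod m(\theta)\}$, and for $k\ge1$, $0\le j\le r^k-2$ put $$P(p,j,k)=\{\theta^k(a)_j\,\theta^k(a)_{j+1}: a\in S_p\}.$$ Let $P_\theta$ be the set of two-letter words that occur in some point of $X_\theta$, and assume (v) the sets $P(p,j,k)$ form a partition of $P_\theta$. Write $[ab]$ for the class containing $ab\in P_\theta$. The intermediate substitution $\phi$ of length $r$ has these classes as its alphabet $\mathcal B$; for $b\in\mathcal B$ it is given by $$\phi(b)_0=b,\qquad \phi(b)_h=[\theta(a_b)_{h-1}\theta(a_b)_h]\quad(1\le h\le r-1),$$ where $a_b$ is any last letter of a word in the class $b$. Theorem. $(X_\phi,\sigma)$ is an almost automorphic (almost one-to-one) extension of its maximal equicontinuous factor. That is, $(X_\phi,\sigma)$ has a maximal equicontinuous factor $\pi:(X_\phi,\sigma)\to(Y,S)$ — a compact Hausdorff equicontinuous factor through which every factor map from $(X_\phi,\sigma)$ to an equicontinuous system factors — and for every such $\pi$ there is a residual set of points $x\in X_\phi$ with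 $\pi^{-1}(\pi(x))=\{x\}$; in particular $\pi$ is one-to-one on a residual set. -/

import Mathlib

open Topology

/-! ### Topological dynamical systems -/

/-- `π` is a factor map (surjective homomorphism) of dynamical systems `(X, T) → (Y, S)`. -/
structure IsFactorMap {X Y : Type} [TopologicalSpace X] [TopologicalSpace Y]
    (T : X ≃ₜ X) (S : Y ≃ₜ Y) (π : X → Y) : Prop where
  continuous : Continuous π
  surjective : Function.Surjective π
  comm : ∀ x, π (T x) = S (π x)

/-- The system `(Y, S)` is equicontinuous: its topology comes from a metric for which the family
of all powers `S ^ n`, `n ∈ ℤ`, is uniformly equicontinuous. -/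
def IsEquicontinuousSystem {Y : Type} [t : TopologicalSpace Y] (S : Y ≃ₜ Y) : Prop :=
  ∃ d : MetricSpace Y, d.toPseudoMetricSpace.toUniformSpace.toTopologicalSpace = t ∧
    ∀ ε : ℝ, 0 < ε → ∃ δ : ℝ, 0 < δ ∧ ∀ x y : Y, d.dist x y < δ →
      ∀ n : ℤ, d.dist ((S ^ n) x) ((S ^ n) y) < ε

/-- `π : (X, T) → (Y, S)` is the maximal equicontinuous factor of `(X, T)`: the compact Hausdorff
system `(Y, S)` is an equicontinuous factor, and every equicontinuous factor of `(X, T)` is a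
factor of `(Y, S)`, compatibly with the maps from `X`. (Every compact Hausdorff factor of
a system `X : Type` is isomorphic to one carried by a quotient of `X`, so testing against systems
in `Type` loses nothing.) -/
structure IsMaximalEquicontinuousFactor {X Y : Type} [TopologicalSpace X] [TopologicalSpace Y]
    (T : X ≃ₜ X) (S : Y ≃ₜ Y) (π : X → Y) : Prop where
  compact : CompactSpace Y
  hausdorff : T2Space Y
  factor : IsFactorMap T S π
  equicontinuous : IsEquicontinuousSystem S
  maximal : ∀ (Z : Type) [TopologicalSpace Z] [CompactSpace Z] [T2Space Z] (R : Z ≃ₜ Z)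
    (ρ : X → Z), IsFactorMap T R ρ → IsEquicontinuousSystem R →
      ∃ g : Y → Z, IsFactorMap S R g ∧ ∀ x, g (π x) = ρ x

/-- `π` is almost one-to-one (almost automorphic): there is a residual set of points of `X` which
are alone in their `π`-fibre. In particular `π` restricted to this residual set is injective. -/
def IsAlmostOneToOne {X Y : Type} [TopologicalSpace X] (π : X → Y) : Prop :=
  {x : X | ∀ x' : X, π x' = π x → x' = x} ∈ residual X

/-! ### Substitutions of constant length -/

/-- A substitution of constant length `r` over the alphabet `A`; `θ a h` is the `h`-th letter
(`0 ≤ h < r`) of the word `θ(a)`. -/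
abbrev Substitution (A : Type) (r : ℕ) : Type := A → Fin r → A

namespace Substitution

section General

variable {A : Type} {r : ℕ} [NeZero r]

/-- `θ.pow k a n` is the `n`-th letter of the word `θ^k(a)`; it is only meaningful for
`n < r ^ k`, the length of that word. The letter `θ^(k+1)(a)_n` is the letter with index `n mod r`
of the image of the letter `θ^k(a)_(n / r)`. -/
def pow (θ : Substitution A r) : ℕ → A → ℕ → A
  | 0, a, _ => a
  | k + 1, a, n => θ (pow θ k a (n / r)) (Fin.ofNat r n)

/-- For some `k`, every letter occurs in `θ^k(a)`, for every letter `a`. -/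
def IsPrimitive (θ : Substitution A r) : Prop :=
  ∃ k : ℕ, ∀ a b : A, ∃ n < r ^ k, θ.pow k a n = b

/-- `θ(a)` begins and ends with the letter `a`, for every letter `a`. -/
def IsCanonical (θ : Substitution A r) : Prop :=
  ∀ a : A, ∀ h : Fin r, (h : ℕ) = 0 ∨ (h : ℕ) + 1 = r → θ a h = a

/-- The images of distinct letters differ at every position. -/
def IsCoincidenceFree (θ : Substitution A r) : Prop :=
  ∀ a b : A, a ≠ b → ∀ h : Fin r, θ a h ≠ θ b h

/-- For a canonical `θ` of length `r ≥ 2` (so that the `θ^k(a)` are prefixes of each other, and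
`n < r ^ n`), this is the right-infinite fixed point of `θ` which begins with the letter `a`. -/
def fixedWord (θ : Substitution A r) (a : A) : ℕ → A := fun n => θ.pow n a n

/-- The substitution space: the bi-infinite words all of whose finite subwords
`x_i x_(i+1) … x_(i+l-1)` occur in some `θ^k(a)`. For a primitive substitution this is the closure
of the shift orbit of any bi-infinite fixed point whose two central letters `x_(-1) x_0` occur
next to each other in some `θ^k(a)`. -/
def space (θ : Substitution A r) : Set (ℤ → A) :=
  {x | ∀ (i : ℤ) (l : ℕ), ∃ (a : A) (k n : ℕ), n + l ≤ r ^ k ∧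
    ∀ j : ℕ, j < l → x (i + j) = θ.pow k a (n + j)}

theorem space_translate (θ : Substitution A r) (c : ℤ) {x : ℤ → A} (hx : x ∈ θ.space) :
    (fun i => x (i + c)) ∈ θ.space := by
  intro i l
  obtain ⟨a, k, n, h, H⟩ := hx (i + c) l
  refine ⟨a, k, n, h, fun j hj => ?_⟩
  rw [← H j hj]
  exact congrArg x (by ring)

/-- The shift `(σ x)_n = x_(n+1)` as a homeomorphism of the substitution space (with the topology
induced from the product topology). -/
def shift [TopologicalSpace A] (θ : Substitution A r) : θ.space ≃ₜ θ.space where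
  toFun x := ⟨fun i => x.1 (i + 1), θ.space_translate 1 x.2⟩
  invFun x := ⟨fun i => x.1 (i + -1), θ.space_translate (-1) x.2⟩
  left_inv x := Subtype.ext (funext fun i => congrArg x.1 (by ring))
  right_inv x := Subtype.ext (funext fun i => congrArg x.1 (by ring))
  continuous_toFun := Continuous.subtype_mk (continuous_pi fun i => by
    exact (continuous_apply (i + 1)).comp continuous_subtype_val) _
  continuous_invFun := Continuous.subtype_mk (continuous_pi fun i => by
    exact (continuous_apply (i + -1)).comp continuous_subtype_val) _

/-- The two-letter words which occur in some point of the substitution space. -/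
def legalPairs (θ : Substitution A r) : Set (A × A) :=
  {w | ∃ x ∈ θ.space, ∃ i : ℤ, x i = w.1 ∧ x (i + 1) = w.2}

end General

/-! ### Height, letter classes, and classes of two-letter words -/

section Classes

variable {N r : ℕ} [NeZero r]

/-- `θ` is injective on letters, and its fixed point is not periodic. -/
def IsAdmissible (θ : Substitution (Fin (N + 1)) r) : Prop :=
  Function.Injective θ ∧
    ¬ ∃ p : ℕ, 0 < p ∧ ∀ n : ℕ, θ.fixedWord 0 (n + p) = θ.fixedWord 0 n

/-- The greatest common divisor of the positive positions of the letter `0` in the fixed point of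
`θ` beginning with `0`. -/
noncomputable def returnGcd (θ : Substitution (Fin (N + 1)) r) : ℕ :=
  sSup {d : ℕ | ∀ n : ℕ, 0 < n → θ.fixedWord 0 n = 0 → d ∣ n}

/-- The height `m(θ)`: the product, with multiplicity, of the prime factors of `returnGcd θ` which
do not divide the length `r`. -/
noncomputable def height (θ : Substitution (Fin (N + 1)) r) : ℕ :=
  (θ.returnGcd.primeFactorsList.filter (fun p => ¬ p ∣ r)).prod

/-- The position of the first letter `0` in the fixed point of `θ` which begins with `a` (this is
the position of the first `0` in `θ(a)` as soon as `θ(a)` contains a `0`). -/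
noncomputable def firstZero (θ : Substitution (Fin (N + 1)) r) (a : Fin (N + 1)) : ℕ :=
  sInf {n : ℕ | θ.fixedWord a n = 0}

/-- The classes of letters `S_p`, for `p` modulo `m(θ)`. -/
def letterClass (θ : Substitution (Fin (N + 1)) r) (p : ZMod θ.height) : Set (Fin (N + 1)) :=
  {a | (θ.firstZero a : ZMod θ.height) = -p}

/-- `P(p, j, k)`: the two-letter words at the positions `j, j + 1` of `θ^k(a)`, for `a ∈ S_p`. -/
def pairSet (θ : Substitution (Fin (N + 1)) r) (p : ZMod θ.height) (j k : ℕ) :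
    Set (Fin (N + 1) × Fin (N + 1)) :=
  {w | ∃ a ∈ θ.letterClass p, w = (θ.pow k a j, θ.pow k a (j + 1))}

/-- The collection of all the sets `P(p, j, k)` with `k ≥ 1` and `0 ≤ j ≤ r ^ k - 2`. -/
def pairSets (θ : Substitution (Fin (N + 1)) r) : Set (Set (Fin (N + 1) × Fin (N + 1))) :=
  {C | ∃ (p : ZMod θ.height) (j k : ℕ), 0 < k ∧ j + 1 < r ^ k ∧ C = θ.pairSet p j k}

/-- The sets `P(p, j, k)` form a partition of the set of legal two-letter words. -/
structure PairsPartition (θ : Substitution (Fin (N + 1)) r) : Prop where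
  nonempty : ∀ C ∈ θ.pairSets, C.Nonempty
  disjoint : ∀ C ∈ θ.pairSets, ∀ D ∈ θ.pairSets, C ≠ D → Disjoint C D
  union : ⋃₀ θ.pairSets = θ.legalPairs

/-- The alphabet `𝓑` of the intermediate substitution: its letters are the partition classes
`P(p, j, k)`. -/
def PairClass (θ : Substitution (Fin (N + 1)) r) : Type := {C // C ∈ θ.pairSets}

instance (θ : Substitution (Fin (N + 1)) r) : TopologicalSpace θ.PairClass := ⊥

instance (θ : Substitution (Fin (N + 1)) r) : DiscreteTopology θ.PairClass := ⟨rfl⟩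

theorem exists_pairSet (θ : Substitution (Fin (N + 1)) r) (a : Fin (N + 1)) (h g : Fin r)
    (hg : (g : ℕ) + 1 = h) : ∃ C ∈ θ.pairSets, (θ a g, θ a h) ∈ C := by
  refine ⟨_, ⟨-(θ.firstZero a : ZMod θ.height), g, 1, one_pos, ?_, rfl⟩, a, ?_, ?_⟩
  · rw [pow_one, hg]; exact h.2
  · exact (neg_neg _).symm
  · have e : ∀ f : Fin r, θ a (Fin.ofNat r f) = θ a f := fun f =>
      congrArg (θ a) (Fin.ext (Nat.mod_eq_of_lt f.2))
    simp only [pow, hg, e]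

/-- `[θ(a)_g θ(a)_h]`, for consecutive positions `g, h` of `θ(a)`: a class which contains this
two-letter word (the only one, if the classes form a partition). -/
noncomputable def pairClassAt (θ : Substitution (Fin (N + 1)) r) (a : Fin (N + 1)) (h g : Fin r)
    (hg : (g : ℕ) + 1 = h) : θ.PairClass :=
  ⟨(θ.exists_pairSet a h g hg).choose, (θ.exists_pairSet a h g hg).choose_spec.1⟩

/-- The intermediate substitution `φ` over the classes of two-letter words. Given a choice
`last b` of a last letter of a word of the class `b`, the word `φ(b)` has the letters
`φ(b)_0 = b` and `φ(b)_h = [θ(last b)_(h-1) θ(last b)_h]` for `1 ≤ h < r`. -/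
noncomputable def intermediate (θ : Substitution (Fin (N + 1)) r)
    (last : θ.PairClass → Fin (N + 1)) : Substitution θ.PairClass r :=
  fun b h =>
    if h0 : (h : ℕ) = 0 then b
    else θ.pairClassAt (last b) h ⟨h - 1, by have := h.2; omega⟩ (by simp only; omega)

end Classes

end Substitution

/-! Write c(b) for `firstZero (last b)` modulo the height m. For i > 0 the letter φ^k(b)_i is the
class of the word at positions i-1, i of θ^k(last b) (`mem_intermediate_pow`), and by the partition
hypothesis this class depends on b only through c(b) (`intermediate_pow_congr`). Along a point y of
X_φ the residue c(y_n) has period m in n (`firstZero_last_periodic`). Hence in φ^k(y) every position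
that is not a multiple of r^k carries a letter repeated with period m r^k.

As φ is primitive, X_φ is minimal, and the orbit closures of x under all positive powers of the
shift define an equicontinuous factor ρ. A point in which each position recurs along an arithmetic
progression is alone in its ρ-fibre (`eq_of_rationalCoding_eq`); the words φ^k(y) show that such
points form a dense G_δ (`isAlmostOneToOne_rationalCoding`).

Two points of one ρ-fibre are then proximal, so every equicontinuous factor identifies them and ρ is
maximal. Any other maximal factor maps onto ρ, so its fibres are no larger. -/

/-! ### Minimal systems and their rational factor -/

section Dynamics

variable {X Y : Type} [TopologicalSpace X] [TopologicalSpace Y]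

/-- Every two-sided orbit of `T` is dense. -/
def IsMinimalSystem (T : X ≃ₜ X) : Prop :=
  ∀ x : X, Dense (Set.range fun n : ℤ => (T ^ n) x)

theorem Homeomorph.zpow_add_apply (T : X ≃ₜ X) (m n : ℤ) (x : X) :
    (T ^ (m + n)) x = (T ^ m) ((T ^ n) x) := by
  rw [zpow_add, Homeomorph.mul_apply]

theorem IsFactorMap.zpow {T : X ≃ₜ X} {S : Y ≃ₜ Y} {π : X → Y} (h : IsFactorMap T S π)
    (n : ℤ) (x : X) : π ((T ^ n) x) = (S ^ n) (π x) := by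
  have hinv : ∀ x, π (T⁻¹ x) = S⁻¹ (π x) := fun x => by
    rw [Homeomorph.inv_apply, Homeomorph.inv_apply, Homeomorph.eq_symm_apply, ← h.comm,
      Homeomorph.apply_symm_apply]
  induction n generalizing x with
  | zero => simp
  | succ n ih => rw [Homeomorph.zpow_add_apply, Homeomorph.zpow_add_apply, ih]; simp [h.comm]
  | pred n ih =>
    rw [sub_eq_add_neg, Homeomorph.zpow_add_apply, Homeomorph.zpow_add_apply, ih, zpow_neg_one,
      zpow_neg_one, hinv]

/-- The orbit closure of `x` under `T ^ N`. -/
def orbitPart (T : X ≃ₜ X) (N : ℕ) (x : X) : Set X :=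
  closure (Set.range fun n : ℤ => (T ^ (N * n)) x)

variable (T : X ≃ₜ X) (N : ℕ)

theorem mem_orbitPart_self (x : X) : x ∈ orbitPart T N x :=
  subset_closure ⟨0, by simp⟩

theorem isClosed_orbitPart (x : X) : IsClosed (orbitPart T N x) := isClosed_closure

theorem zpow_image_orbitPart (i : ℤ) (x : X) :
    (T ^ i) '' orbitPart T N x = orbitPart T N ((T ^ i) x) := by
  rw [orbitPart, orbitPart, Homeomorph.image_closure, ← Set.range_comp]
  congr 2
  funext n
  simp only [Function.comp_apply, ← Homeomorph.zpow_add_apply, add_comm]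

theorem image_orbitPart (x : X) : T '' orbitPart T N x = orbitPart T N (T x) := by
  simpa using zpow_image_orbitPart T N 1 x

theorem orbitPart_zpow_mul (n : ℤ) (x : X) :
    orbitPart T N ((T ^ (N * n)) x) = orbitPart T N x := by
  rw [orbitPart, orbitPart]
  congr 1
  ext y
  constructor
  · rintro ⟨k, rfl⟩
    exact ⟨k + n, by simp only [mul_add, Homeomorph.zpow_add_apply]⟩
  · rintro ⟨k, rfl⟩
    exact ⟨k - n, by simp only [← Homeomorph.zpow_add_apply]; congr 2; ring⟩

theorem orbitPart_subset_of_mem {x y : X} (h : y ∈ orbitPart T N x) :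
    orbitPart T N y ⊆ orbitPart T N x := by
  refine closure_minimal ?_ (isClosed_orbitPart T N x)
  rintro _ ⟨n, rfl⟩
  rw [← orbitPart_zpow_mul T N n x, ← zpow_image_orbitPart]
  exact ⟨y, h, rfl⟩

variable {T N}

theorem IsMinimalSystem.exists_mem_orbitPart (hT : IsMinimalSystem T) (hN : 0 < N) (x y : X) :
    ∃ i < N, y ∈ orbitPart T N ((T ^ (i : ℤ)) x) := by
  have hc : IsClosed (⋃ i ∈ Finset.range N, orbitPart T N ((T ^ (i : ℤ)) x)) :=
    isClosed_biUnion_finset fun i _ => isClosed_orbitPart T N _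
  have hs : (Set.range fun n : ℤ => (T ^ n) x) ⊆
      ⋃ i ∈ Finset.range N, orbitPart T N ((T ^ (i : ℤ)) x) := by
    rintro _ ⟨n, rfl⟩
    have h0 : 0 ≤ n % N := Int.emod_nonneg _ (by omega)
    have h1 : n % N < N := Int.emod_lt_of_pos _ (by omega)
    simp only [Set.mem_iUnion, Finset.mem_range]
    refine ⟨(n % N).toNat, by omega, subset_closure ⟨n / N, ?_⟩⟩
    simp only [Int.toNat_of_nonneg h0, ← Homeomorph.zpow_add_apply, Int.mul_ediv_add_emod]
  have := closure_minimal hs hc (hT x y)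
  simpa using this

/-- Write O(x) for the part of x. Some i gives O(x) ⊆ O(T^i y) ⊆ O(T^i x). Iterating N times returns
to O(x), so O(T^i x) ⊆ O(x) ⊆ O(T^i y); applying T^(-i) gives O(x) ⊆ O(y). -/
theorem IsMinimalSystem.orbitPart_eq_of_mem (hT : IsMinimalSystem T) (hN : 0 < N) {x y : X}
    (h : y ∈ orbitPart T N x) : orbitPart T N y = orbitPart T N x := by
  have himg : ∀ {u v : X} (i : ℤ), orbitPart T N u ⊆ orbitPart T N v →
      orbitPart T N ((T ^ i) u) ⊆ orbitPart T N ((T ^ i) v) := fun i h => by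
    rw [← zpow_image_orbitPart, ← zpow_image_orbitPart]
    exact Set.image_mono h
  obtain ⟨i, -, hi⟩ := hT.exists_mem_orbitPart hN y x
  have h1 := orbitPart_subset_of_mem T N h
  have h2 := orbitPart_subset_of_mem T N hi
  have h3 := himg i h1
  have h4 : ∀ j : ℕ, orbitPart T N ((T ^ (i : ℤ)) x) ⊆
      orbitPart T N ((T ^ ((i : ℤ) * (j + 1))) x) := by
    intro j
    induction j with
    | zero => simp
    | succ j ih =>
      refine ih.trans ?_
      have := himg ((i : ℤ) * (j + 1)) (h2.trans h3)
      rwa [← Homeomorph.zpow_add_apply,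
        show (i : ℤ) * (j + 1) + i = i * ((j + 1 : ℕ) + 1) by push_cast; ring] at this
  have h5 : orbitPart T N ((T ^ (i : ℤ)) x) ⊆ orbitPart T N x := by
    have := h4 (N - 1)
    rwa [Nat.cast_sub (by omega), Nat.cast_one, sub_add_cancel, mul_comm, orbitPart_zpow_mul]
      at this
  have h6 := himg (-i) (h5.trans h2)
  rw [← Homeomorph.zpow_add_apply, ← Homeomorph.zpow_add_apply, neg_add_cancel, zpow_zero] at h6
  exact h1.antisymm h6

theorem IsMinimalSystem.isOpen_orbitPart (hT : IsMinimalSystem T) (hN : 0 < N) (x : X) :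
    IsOpen (orbitPart T N x) := by
  classical
  have hc : IsClosed (⋃ i ∈ (Finset.range N).filter
      (fun i : ℕ => x ∉ orbitPart T N ((T ^ (i : ℤ)) x)), orbitPart T N ((T ^ (i : ℤ)) x)) :=
    isClosed_biUnion_finset fun i _ => isClosed_orbitPart T N _
  convert hc.isOpen_compl using 1
  ext y
  simp only [Set.mem_compl_iff, Set.mem_iUnion, Finset.mem_filter, Finset.mem_range]
  constructor
  · rintro hy ⟨i, ⟨-, hi⟩, hyi⟩
    rw [← hT.orbitPart_eq_of_mem hN hyi, hT.orbitPart_eq_of_mem hN hy] at hi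
    exact hi (mem_orbitPart_self T N x)
  · intro hy
    obtain ⟨i, hi, hyi⟩ := hT.exists_mem_orbitPart hN x y
    by_contra hyx
    refine hy ⟨i, ⟨hi, fun hx => hyx ?_⟩, hyi⟩
    rwa [hT.orbitPart_eq_of_mem hN hx]

/-- Sets of points of `X`, as a discrete space. -/
def OrbitParts (X : Type) : Type := Set X

instance : TopologicalSpace (OrbitParts X) := ⊥

instance : DiscreteTopology (OrbitParts X) := ⟨rfl⟩

/-- The sequence of the orbit closures of a point under all positive powers of `T`. -/
def rationalCoding (T : X ≃ₜ X) (x : X) : ℕ → OrbitParts X := fun N => orbitPart T (N + 1) x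

theorem IsMinimalSystem.continuous_rationalCoding (hT : IsMinimalSystem T) :
    Continuous (rationalCoding T) := by
  refine continuous_pi fun N => IsLocallyConstant.continuous ?_
  rw [IsLocallyConstant.iff_exists_open]
  exact fun x => ⟨_, hT.isOpen_orbitPart N.succ_pos x, mem_orbitPart_self T _ x,
    fun y hy => hT.orbitPart_eq_of_mem N.succ_pos hy⟩

/-- The action of `T` on sequences of sets of points. -/
def setShift (T : X ≃ₜ X) : (ℕ → OrbitParts X) ≃ₜ (ℕ → OrbitParts X) :=
  Homeomorph.piCongrRight fun _ =>
    { toEquiv := (Equiv.Set.congr T.toEquiv : Set X ≃ Set X)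
      continuous_toFun := continuous_of_discreteTopology
      continuous_invFun := continuous_of_discreteTopology }

theorem setShift_rationalCoding (x : X) :
    setShift T (rationalCoding T x) = rationalCoding T (T x) :=
  funext fun N => image_orbitPart T (N + 1) x

/-- The action of `T` on the image of the coding by orbit closures. -/
def rationalShift (T : X ≃ₜ X) : Set.range (rationalCoding T) ≃ₜ Set.range (rationalCoding T) :=
  (setShift T).subtype fun z => by
    constructor
    · rintro ⟨x, rfl⟩
      exact ⟨T x, (setShift_rationalCoding x).symm⟩
    · rintro ⟨x, hx⟩
      refine ⟨T.symm x, (setShift T).injective ?_⟩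
      rw [setShift_rationalCoding, T.apply_symm_apply, hx]

theorem IsMinimalSystem.isFactorMap_rationalCoding (hT : IsMinimalSystem T) :
    IsFactorMap T (rationalShift T) (Set.rangeFactorization (rationalCoding T)) where
  continuous := hT.continuous_rationalCoding.subtype_mk _
  surjective := Set.rangeFactorization_surjective
  comm x := Subtype.ext (setShift_rationalCoding x).symm

theorem rationalShift_zpow_congr {y z : Set.range (rationalCoding T)} {i : ℕ}
    (h : y.1 i = z.1 i) (n : ℤ) :
    ((rationalShift T ^ n) y).1 i = ((rationalShift T ^ n) z).1 i := by
  have hinv : ∀ y z : Set.range (rationalCoding T), y.1 i = z.1 i →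
      ((rationalShift T)⁻¹ y).1 i = ((rationalShift T)⁻¹ z).1 i := fun y z h =>
    congrArg (Equiv.Set.congr T.toEquiv).symm h
  have hfwd : ∀ y z : Set.range (rationalCoding T), y.1 i = z.1 i →
      (rationalShift T y).1 i = (rationalShift T z).1 i := fun y z h =>
    congrArg (Equiv.Set.congr T.toEquiv) h
  induction n generalizing y z with
  | zero => simpa using h
  | succ n ih =>
    rw [Homeomorph.zpow_add_apply, Homeomorph.zpow_add_apply]
    exact ih (by simpa using hfwd y z h)
  | pred n ih =>
    rw [sub_eq_add_neg, Homeomorph.zpow_add_apply, Homeomorph.zpow_add_apply]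
    exact ih (by simpa using hinv y z h)

/-- The shift acts on each coordinate separately and bijectively, so agreement on the first n
coordinates is never lost. -/
theorem isEquicontinuousSystem_rationalShift (T : X ≃ₜ X) :
    IsEquicontinuousSystem (rationalShift T) := by
  let _ : MetricSpace (ℕ → OrbitParts X) := PiNat.metricSpace
  refine ⟨inferInstance, rfl, fun ε hε => ?_⟩
  obtain ⟨n, hn⟩ := exists_pow_lt_of_lt_one hε (one_half_lt_one (α := ℝ))
  refine ⟨(1 / 2) ^ n, by positivity, fun y z hyz k => lt_of_le_of_lt ?_ hn⟩
  have h1 : y.1 ∈ PiNat.cylinder z.1 n := PiNat.mem_cylinder_iff_dist_le.2 (le_of_lt hyz)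
  refine PiNat.mem_cylinder_iff_dist_le.1 (PiNat.mem_cylinder_iff.2 fun i hi => ?_)
  exact rationalShift_zpow_congr (PiNat.mem_cylinder_iff.1 h1 i hi) k

/-! ### Almost one-to-one equicontinuous factors -/

/-- At a time n when the two orbits are close, so are their images; equicontinuity carries this back
to time 0 through S^(-n). -/
theorem IsFactorMap.eq_of_proximal {T : X ≃ₜ X} {S : Y ≃ₜ Y} {π : X → Y} (h : IsFactorMap T S π)
    (hS : IsEquicontinuousSystem S) {x x' x₀ : X}
    (hx : (x₀, x₀) ∈ closure (Set.range fun n : ℤ => ((T ^ n) x, (T ^ n) x'))) : π x = π x' := by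
  obtain ⟨d, rfl, hd⟩ := hS
  refine eq_of_forall_dist_le fun ε hε => ?_
  obtain ⟨δ, hδ, H⟩ := hd ε hε
  have ho : IsOpen {p : X × X | dist (π p.1) (π p.2) < δ} :=
    isOpen_lt ((h.continuous.comp continuous_fst).dist (h.continuous.comp continuous_snd))
      continuous_const
  obtain ⟨_, hp, n, rfl⟩ := mem_closure_iff.1 hx _ ho (by simpa using hδ)
  have := H _ _ hp (-n)
  simp only [← h.zpow, ← Homeomorph.zpow_add_apply, neg_add_cancel, zpow_zero] at this
  exact this.le

theorem IsMinimalSystem.isMaximalEquicontinuousFactor [CompactSpace X] [T2Space X]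
    {T : X ≃ₜ X} (hT : IsMinimalSystem T) [CompactSpace Y] [T2Space Y]
    {S : Y ≃ₜ Y} {π : X → Y} (hπ : IsFactorMap T S π) (hS : IsEquicontinuousSystem S)
    (h1 : IsAlmostOneToOne π) : IsMaximalEquicontinuousFactor T S π := by
  refine ⟨inferInstance, inferInstance, hπ, hS, fun Z _ _ _ R ρ hρ hR => ?_⟩
  have key : ∀ x x' : X, π x = π x' → ρ x = ρ x' := by
    intro x x' hxx
    have : Nonempty X := ⟨x⟩
    obtain ⟨x₀, hx₀⟩ := (dense_of_mem_residual h1).nonempty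
    set D := closure (Set.range fun n : ℤ => ((T ^ n) x, (T ^ n) x')) with hD
    have hfst : IsClosed (Prod.fst '' D) := isClosedMap_fst_of_compactSpace _ isClosed_closure
    have hsub : (Set.range fun n : ℤ => (T ^ n) x) ⊆ Prod.fst '' D := by
      rintro _ ⟨n, rfl⟩
      exact ⟨_, subset_closure ⟨n, rfl⟩, rfl⟩
    -- By compactness the projection of the pair orbit closure is closed, so by minimality it
    -- reaches the point with a trivial fibre; the partner is forced to coincide with it.
    obtain ⟨⟨y₁, y⟩, hy, rfl⟩ := closure_minimal hsub hfst (hT x x₀)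
    have hcl : IsClosed {p : X × X | π p.1 = π p.2} :=
      isClosed_eq (hπ.continuous.comp continuous_fst) (hπ.continuous.comp continuous_snd)
    have hy' : π y₁ = π y := by
      refine closure_minimal ?_ hcl hy
      rintro _ ⟨n, rfl⟩
      simp only [Set.mem_ofPred_eq, hπ.zpow, hxx]
    have : y = y₁ := hx₀ y hy'.symm
    subst this
    exact hρ.eq_of_proximal hR hy
  choose s hs using hπ.surjective
  have hg : ∀ x, ρ (s (π x)) = ρ x := fun x => key _ _ (hs _)
  have hq : Topology.IsQuotientMap π :=
    hπ.continuous.isClosedMap.isQuotientMap hπ.continuous hπ.surjective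
  refine ⟨fun y => ρ (s y), ⟨?_, ?_, ?_⟩, hg⟩
  · rw [hq.continuous_iff]
    convert hρ.continuous using 1
    exact funext hg
  · intro z
    obtain ⟨x, rfl⟩ := hρ.surjective z
    exact ⟨π x, hg x⟩
  · intro y
    obtain ⟨x, rfl⟩ := hπ.surjective y
    simp only [← hπ.comm, hg, hρ.comm]

theorem IsMaximalEquicontinuousFactor.isAlmostOneToOne {T : X ≃ₜ X} {S : Y ≃ₜ Y} {π : X → Y}
    (hπ : IsMaximalEquicontinuousFactor T S π) {Z : Type} [TopologicalSpace Z] [CompactSpace Z]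
    [T2Space Z] {R : Z ≃ₜ Z} {ρ : X → Z} (hρ : IsFactorMap T R ρ)
    (hR : IsEquicontinuousSystem R) (h1 : IsAlmostOneToOne ρ) : IsAlmostOneToOne π := by
  obtain ⟨g, -, hg⟩ := hπ.maximal Z R ρ hρ hR
  refine Filter.mem_of_superset h1 fun x hx x' hx' => hx x' ?_
  rw [← hg, ← hg, hx']

theorem IsMinimalSystem.compactSpace_range_rationalCoding [CompactSpace X] {T : X ≃ₜ X}
    (hT : IsMinimalSystem T) : CompactSpace (Set.range (rationalCoding T)) :=
  isCompact_iff_compactSpace.1 (isCompact_range hT.continuous_rationalCoding)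

end Dynamics

/-! ### Powers of a substitution, and their action on bi-infinite words -/

namespace Substitution

section General

variable {A : Type} {r : ℕ} [NeZero r]

theorem pow_add (θ : Substitution A r) (k l : ℕ) (a : A) (n : ℕ) :
    θ.pow (k + l) a n = θ.pow k (θ.pow l a (n / r ^ k)) (n % r ^ k) := by
  induction k generalizing n with
  | zero => simp [pow]
  | succ k ih =>
    rw [show k + 1 + l = k + l + 1 by omega]
    simp only [pow]
    rw [ih, Nat.div_div_eq_div_mul, ← pow_succ', pow_succ' r k, Nat.mod_mul_right_div_self,
      ← Nat.mod_mul_right_div_self]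
    congr 1
    exact Fin.ext (by simp [Fin.ofNat])

theorem pow_add_apply (θ : Substitution A r) (k l : ℕ) (a : A) (n i : ℕ) (hi : i < r ^ k) :
    θ.pow (k + l) a (r ^ k * n + i) = θ.pow k (θ.pow l a n) i := by
  rw [pow_add, Nat.mul_add_div (by omega), Nat.div_eq_of_lt hi, Nat.mul_add_mod,
    Nat.mod_eq_of_lt hi, add_zero]

theorem pow_one_apply (θ : Substitution A r) (a : A) (h : Fin r) : θ.pow 1 a h = θ a h := by
  simp only [pow]
  congr 1
  exact Fin.ext (Nat.mod_eq_of_lt h.2)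

theorem pow_apply_zero (θ : Substitution A r) (h0 : ∀ a, ∀ h : Fin r, (h : ℕ) = 0 → θ a h = a)
    (k : ℕ) (a : A) : θ.pow k a 0 = a := by
  induction k with
  | zero => rfl
  | succ k ih =>
    simp only [pow, Nat.zero_div, ih]
    exact h0 _ _ (by simp [Fin.ofNat])

theorem pow_of_le (θ : Substitution A r) (h0 : ∀ a, ∀ h : Fin r, (h : ℕ) = 0 → θ a h = a)
    {k l : ℕ} (hkl : k ≤ l) (a : A) {n : ℕ} (hn : n < r ^ k) : θ.pow l a n = θ.pow k a n := by
  obtain ⟨m, rfl⟩ := Nat.exists_eq_add_of_le hkl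
  rw [pow_add, Nat.div_eq_of_lt hn, Nat.mod_eq_of_lt hn, pow_apply_zero θ h0]

/-- The image of a bi-infinite word under the `k`-th power of a substitution. -/
def inflate (θ : Substitution A r) (k : ℕ) (y : ℤ → A) : ℤ → A :=
  fun n => θ.pow k (y (n / (r ^ k : ℕ))) (n % (r ^ k : ℕ)).toNat

theorem inflate_apply (θ : Substitution A r) (k : ℕ) (y : ℤ → A) (q : ℤ) {i : ℕ}
    (hi : i < r ^ k) : θ.inflate k y ((r ^ k : ℕ) * q + i) = θ.pow k (y q) i := by
  have h1 : (((r ^ k : ℕ) : ℤ) * q + i) / (r ^ k : ℕ) = q := by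
    rw [Int.mul_add_ediv_left _ _ (by omega), Int.ediv_eq_zero_of_lt (by omega) (by omega),
      add_zero]
  have h2 : (((r ^ k : ℕ) : ℤ) * q + i) % (r ^ k : ℕ) = i := by
    rw [Int.mul_add_emod_self_left, Int.emod_eq_of_lt (by omega) (by omega)]
  rw [inflate, h1, h2, Int.toNat_natCast]

theorem inflate_mem_space (θ : Substitution A r) (k : ℕ) {y : ℤ → A} (hy : y ∈ θ.space) :
    θ.inflate k y ∈ θ.space := by
  intro i l
  have hR : 0 < r ^ k := Nat.pow_pos (Nat.pos_of_neZero r)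
  set R := r ^ k with hRdef
  -- A window of length l meets at most l + 1 blocks.
  obtain ⟨a, K, n, h, H⟩ := hy (i / R) (l + 1)
  have h0 : 0 ≤ i % R := Int.emod_nonneg _ (by omega)
  have h1 : i % R < R := Int.emod_lt_of_pos _ (by omega)
  obtain ⟨s, hs⟩ := Int.eq_ofNat_of_zero_le h0
  have hi : i = R * (i / R) + s := by rw [← hs, Int.mul_ediv_add_emod]
  refine ⟨a, k + K, R * n + s, ?_, fun j hj => ?_⟩
  · rw [_root_.pow_add, ← hRdef]
    nlinarith
  · have hdm := Nat.div_add_mod (s + j) R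
    have hlt : (s + j) % R < R := Nat.mod_lt _ hR
    have hq : (s + j) / R < l + 1 := by
      rw [Nat.div_lt_iff_lt_mul hR]
      nlinarith
    have e1 : i + j = (R : ℕ) * (i / R + ((s + j) / R : ℕ)) + ((s + j) % R : ℕ) := by
      have : ((R : ℤ) * ((s + j) / R : ℕ) + ((s + j) % R : ℕ)) = s + j := by exact_mod_cast hdm
      linarith
    have e2 : R * n + s + j = R * (n + (s + j) / R) + (s + j) % R := by
      rw [mul_add]; omega
    rw [e1, e2, inflate_apply θ k y _ hlt, pow_add_apply θ k K a _ _ hlt, H _ hq]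

theorem isClosed_space [TopologicalSpace A] [DiscreteTopology A] (θ : Substitution A r) :
    IsClosed θ.space := by
  have : θ.space = ⋂ (i : ℤ) (l : ℕ), (fun (x : ℤ → A) (j : Fin l) => x (i + j)) ⁻¹'
      {w | ∃ (a : A) (k n : ℕ), n + l ≤ r ^ k ∧ ∀ j : Fin l, w j = θ.pow k a (n + j)} := by
    ext x
    simp only [space, Set.mem_iInter, Set.mem_preimage, Set.mem_ofPred_eq, Fin.forall_iff]
  rw [this]
  exact isClosed_iInter fun i => isClosed_iInter fun l =>
    (isClosed_discrete _).preimage (continuous_pi fun j => continuous_apply _)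

theorem compactSpace_space [TopologicalSpace A] [DiscreteTopology A] [Finite A]
    (θ : Substitution A r) : CompactSpace θ.space :=
  isCompact_iff_compactSpace.1 θ.isClosed_space.isCompact

theorem shift_zpow_apply [TopologicalSpace A] (θ : Substitution A r) (n : ℤ) (x : θ.space)
    (i : ℤ) : ((θ.shift ^ n) x).1 i = x.1 (i + n) := by
  induction n generalizing x with
  | zero => simp
  | succ n ih =>
    rw [Homeomorph.zpow_add_apply, ih, zpow_one]
    exact congrArg x.1 (by ring)
  | pred n ih =>
    rw [sub_eq_add_neg, Homeomorph.zpow_add_apply, ih, zpow_neg_one]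
    exact congrArg x.1 (by ring)

/-- A window of y lies in some θ^k(a), hence, by primitivity, in every block θ^(k+K)(c); any stretch
of x of length 2R contains such a block. -/
theorem isMinimalSystem_shift [TopologicalSpace A] [DiscreteTopology A] (θ : Substitution A r)
    (hprim : θ.IsPrimitive) : IsMinimalSystem θ.shift := by
  intro x y
  rw [mem_closure_iff_nhds]
  intro U hU
  obtain ⟨V, hV, hVU⟩ := mem_nhds_subtype _ _ _ |>.1 hU
  rw [nhds_pi, Filter.mem_pi'] at hV
  obtain ⟨I, t, ht, hIt⟩ := hV
  obtain ⟨M, hM⟩ : ∃ M : ℕ, ∀ i ∈ I, i.natAbs ≤ M :=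
    ⟨I.sup Int.natAbs, fun i hi => Finset.le_sup (f := Int.natAbs) hi⟩
  obtain ⟨a, k, n, hn, H⟩ := y.2 (-M) (2 * M + 1)
  obtain ⟨K, hK⟩ := hprim
  have hR : 0 < r ^ (k + K) := Nat.pow_pos (Nat.pos_of_neZero r)
  set R := r ^ (k + K) with hRdef
  obtain ⟨c, l, q, hq, Hx⟩ := x.2 0 (2 * R)
  have hl : k + K ≤ l := by
    by_contra hlt
    have := Nat.pow_le_pow_right (Nat.pos_of_neZero r) (le_of_not_ge hlt)
    omega
  obtain ⟨p, rfl⟩ := Nat.exists_eq_add_of_le hl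
  -- The ceiling of q / R: the index of the first full block in the stretch.
  set Q := (q + R - 1) / R with hQ
  have hQ1 : q ≤ R * Q := by
    have := Nat.div_add_mod (q + R - 1) R
    have := Nat.mod_lt (q + R - 1) hR
    rw [← hQ] at *; omega
  have hQ2 : R * Q < q + R := by
    have := Nat.mul_div_le (q + R - 1) R
    rw [← hQ] at this; omega
  obtain ⟨s, hs, hsa⟩ := hK (θ.pow p c Q) a
  have hsR : r ^ k * s + r ^ k ≤ R := by
    rw [hRdef, _root_.pow_add]; nlinarith [Nat.pow_pos (n := k) (Nat.pos_of_neZero r)]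
  -- The successive terms lead to the start of the block, to the copy of θ^k(a) in it, and to the
  -- window in that copy, which must begin at coordinate -M.
  refine ⟨(θ.shift ^ ((R * Q - q + r ^ k * s + n + M : ℕ) : ℤ)) x, hVU ?_, _, rfl⟩
  refine hIt fun i hi => ?_
  obtain ⟨j, hj⟩ : ∃ j : ℕ, (j : ℤ) = i + M := ⟨(i + M).toNat, by have := hM i hi; omega⟩
  have hj2 : j < 2 * M + 1 := by have := hM i hi; omega
  have e1 : ((θ.shift ^ ((R * Q - q + r ^ k * s + n + M : ℕ) : ℤ)) x).1 i = y.1 i := by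
    rw [shift_zpow_apply]
    have e2 : i + ((R * Q - q + r ^ k * s + n + M : ℕ) : ℤ) =
        0 + ((R * Q - q + r ^ k * s + (n + j) : ℕ) : ℤ) := by push_cast; omega
    have e3 : q + (R * Q - q + r ^ k * s + (n + j)) = R * Q + (r ^ k * s + (n + j)) := by omega
    rw [e2, Hx _ (by omega), e3, pow_add_apply _ _ _ _ _ _ (by omega),
      pow_add_apply _ _ _ _ _ _ (by omega), hsa, ← H j hj2]
    exact congrArg y.1 (by omega)
  rw [e1]
  exact mem_of_mem_nhds (ht i)

/-- A point of the substitution space which is constant, in each of its positions, along some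
arithmetic progression through that position, is alone in its fibre of the rational coding. -/
theorem eq_of_rationalCoding_eq [TopologicalSpace A] [DiscreteTopology A] (θ : Substitution A r)
    {x x' : θ.space} (hx : ∀ n : ℤ, ∃ P : ℕ, 0 < P ∧ ∀ q : ℤ, x.1 (n + P * q) = x.1 n)
    (h : rationalCoding θ.shift x' = rationalCoding θ.shift x) : x' = x := by
  refine Subtype.ext (funext fun n => ?_)
  obtain ⟨P, hP, H⟩ := hx n
  obtain ⟨p, rfl⟩ : ∃ p, P = p + 1 := ⟨P - 1, by omega⟩
  have h1 : x' ∈ orbitPart θ.shift (p + 1) x := by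
    have h2 : orbitPart θ.shift (p + 1) x' = orbitPart θ.shift (p + 1) x := congrFun h p
    rw [← h2]
    exact mem_orbitPart_self _ _ _
  have hc : IsClosed {z : θ.space | z.1 n = x.1 n} :=
    isClosed_eq ((continuous_apply n).comp continuous_subtype_val) continuous_const
  refine closure_minimal ?_ hc h1
  rintro _ ⟨q, rfl⟩
  rw [Set.mem_ofPred_eq, shift_zpow_apply, H]

/-- A period valid at x is valid on the whole part of x, which is open. -/
theorem isOpen_setOf_periodic_at [TopologicalSpace A] [DiscreteTopology A] (θ : Substitution A r)
    (hT : IsMinimalSystem θ.shift) (n : ℤ) :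
    IsOpen {x : θ.space | ∃ P : ℕ, 0 < P ∧ ∀ q : ℤ, x.1 (n + P * q) = x.1 n} := by
  rw [isOpen_iff_forall_mem_open]
  rintro x ⟨P, hP, hx⟩
  have hcont : Continuous fun z : θ.space => z.1 n :=
    (continuous_apply n).comp continuous_subtype_val
  have hsub : orbitPart θ.shift P x ⊆ {z : θ.space | z.1 n = x.1 n} := by
    refine closure_minimal ?_ (isClosed_eq hcont continuous_const)
    rintro _ ⟨q, rfl⟩
    rw [Set.mem_ofPred_eq, shift_zpow_apply, hx]
  refine ⟨_, fun z hz => ⟨P, hP, fun q => ?_⟩, hT.isOpen_orbitPart hP x, mem_orbitPart_self _ _ _⟩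
  have h1 : (θ.shift ^ (P * q : ℤ)) z ∈ orbitPart θ.shift P x := by
    rw [← orbitPart_zpow_mul _ _ q x, ← zpow_image_orbitPart]
    exact ⟨z, hz, rfl⟩
  have h2 := hsub h1
  rw [Set.mem_ofPred_eq, shift_zpow_apply] at h2
  rw [h2, hsub hz]

/-- If the letters of the words `θ ^ k (a)`, except the first one, depend only on the value at `a`
of a function which is periodic along the words of the substitution space, then the rational
coding is almost one-to-one. -/
theorem isAlmostOneToOne_rationalCoding [TopologicalSpace A] [DiscreteTopology A] [Finite A]
    (θ : Substitution A r) (hr : 2 ≤ r) (hT : IsMinimalSystem θ.shift) {B : Type*} (f : A → B)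
    {m : ℕ} (hm : 0 < m) (hper : ∀ y ∈ θ.space, ∀ n q : ℤ, f (y (n + m * q)) = f (y n))
    (hcoin : ∀ (k : ℕ) (a b : A) (i : ℕ), f a = f b → 0 < i → i < r ^ k →
      θ.pow k a i = θ.pow k b i) :
    IsAlmostOneToOne (Set.rangeFactorization (rationalCoding θ.shift)) := by
  have := θ.compactSpace_space
  have hdense : ∀ n : ℤ, Dense {x : θ.space | ∃ P : ℕ, 0 < P ∧
      ∀ q : ℤ, x.1 (n + P * q) = x.1 n} := by
    intro n
    rw [dense_iff_inter_open]
    rintro U hU ⟨y, hy⟩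
    -- Compactness bounds the time any point needs to enter U by a uniform L.
    obtain ⟨F, hF⟩ := isCompact_univ.elim_finite_subcover
      (fun j : ℤ => (θ.shift ^ j) ⁻¹' U) (fun j => hU.preimage (θ.shift ^ j).continuous)
      (fun x _ => by
        obtain ⟨_, hz, j, rfl⟩ := (hT x).inter_open_nonempty U hU ⟨y, hy⟩
        exact Set.mem_iUnion.2 ⟨j, hz⟩)
    obtain ⟨L, hL⟩ : ∃ L : ℕ, ∀ j ∈ F, j.natAbs ≤ L :=
      ⟨F.sup Int.natAbs, fun i hi => Finset.le_sup (f := Int.natAbs) hi⟩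
    obtain ⟨k, hk⟩ : ∃ k, 2 * L + 2 < r ^ k := ⟨2 * L + 2, Nat.lt_pow_self (by omega)⟩
    let w : θ.space := ⟨θ.inflate k y.1, θ.inflate_mem_space k y.2⟩
    -- After this shift and a further one by j with |j| ≤ L, coordinate n reads position j + L + 1
    -- of w, which lies strictly between 0 and r^k and so avoids the block start.
    have hw := hF (Set.mem_univ ((θ.shift ^ (L + 1 - n : ℤ)) w))
    simp only [Set.mem_iUnion, Set.mem_preimage] at hw
    obtain ⟨j, hj, hjU⟩ := hw
    have hjL := hL j hj
    refine ⟨_, hjU, m * r ^ k, by positivity, fun q => ?_⟩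
    obtain ⟨i, hi⟩ : ∃ i : ℕ, (i : ℤ) = j + L + 1 := ⟨(j + L + 1).toNat, by omega⟩
    have e : ∀ q : ℤ, n + ((m * r ^ k : ℕ) : ℤ) * q + j + (L + 1 - n) =
        (r ^ k : ℕ) * (0 + m * q) + i := fun q => by rw [hi]; push_cast; ring
    have e0 : n + j + (L + 1 - n) = (r ^ k : ℕ) * 0 + i := by rw [hi]; ring
    rw [shift_zpow_apply, shift_zpow_apply, shift_zpow_apply, shift_zpow_apply, e, e0]
    simp only [w]
    rw [inflate_apply _ _ _ _ (by omega), inflate_apply _ _ _ _ (by omega)]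
    exact hcoin _ _ _ _ (hper _ y.2 _ _) (by omega) (by omega)
  have hres : ∀ᶠ x in residual θ.space, ∀ n : ℤ, ∃ P : ℕ, 0 < P ∧
      ∀ q : ℤ, x.1 (n + P * q) = x.1 n :=
    eventually_countable_forall.2 fun n =>
      residual_of_dense_open (θ.isOpen_setOf_periodic_at hT n) (hdense n)
  exact Filter.mem_of_superset hres fun x hx x' h =>
    θ.eq_of_rationalCoding_eq hx (congrArg Subtype.val h)

end General

end Substitution

/-! ### The height, and the intermediate substitution -/

namespace Substitution

section Classes

variable {N r : ℕ} [NeZero r] {θ : Substitution (Fin (N + 1)) r}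

/-! ### Positions of the letter 0 modulo the height -/

theorem IsCanonical.apply_zero (hcan : θ.IsCanonical) (a : Fin (N + 1)) (h : Fin r)
    (h0 : (h : ℕ) = 0) : θ a h = a :=
  hcan a h (Or.inl h0)

theorem two_le_of_isAdmissible (hadm : θ.IsAdmissible) (hcan : θ.IsCanonical) : 2 ≤ r := by
  by_contra hr
  have hr1 : r = 1 := by have := NeZero.ne r; omega
  have h : ∀ k a n, θ.pow k a n = a := by
    intro k a
    induction k with
    | zero => exact fun _ => rfl
    | succ k ih =>
      intro n
      simp only [pow, ih]
      exact hcan _ _ (Or.inl (by have := (Fin.ofNat r n).2; omega))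
  exact hadm.2 ⟨1, one_pos, fun n => by simp only [fixedWord, h]⟩

theorem IsCanonical.pow_eq_fixedWord (hcan : θ.IsCanonical) (hr : 2 ≤ r) {k n : ℕ}
    (hn : n < r ^ k) (a : Fin (N + 1)) : θ.pow k a n = θ.fixedWord a n := by
  rcases le_total k n with h | h
  · exact (pow_of_le θ hcan.apply_zero h a hn).symm
  · exact pow_of_le θ hcan.apply_zero h a (Nat.lt_pow_self (by omega))

theorem height_dvd_returnGcd (hn : θ.returnGcd ≠ 0) : θ.height ∣ θ.returnGcd := by
  conv_rhs => rw [← Nat.prod_primeFactorsList hn]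
  exact List.filter_sublist.prod_dvd_prod

theorem fixedWord_pred (hcan : θ.IsCanonical) (hr : 2 ≤ r) : θ.fixedWord 0 (r - 1) = 0 := by
  rw [← hcan.pow_eq_fixedWord hr (k := 1) (by rw [pow_one]; omega)]
  have := pow_one_apply θ 0 ⟨r - 1, by omega⟩
  rw [this]
  exact hcan _ _ (Or.inr (by simp only; omega))

theorem height_dvd (hcan : θ.IsCanonical) (hr : 2 ≤ r) {n : ℕ} (hn : θ.fixedWord 0 n = 0) :
    θ.height ∣ n := by
  -- The zero at position r - 1 bounds the common divisors, so the supremum is attained and is not a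
  -- default value.
  have hmem : θ.returnGcd ∈ {d : ℕ | ∀ n : ℕ, 0 < n → θ.fixedWord 0 n = 0 → d ∣ n} :=
    Nat.sSup_mem ⟨1, fun n _ _ => one_dvd n⟩
      ⟨r - 1, fun d hd => Nat.le_of_dvd (by omega) (hd _ (by omega) (fixedWord_pred hcan hr))⟩
  have h0 : θ.returnGcd ≠ 0 := by
    intro h
    rw [h] at hmem
    have := hmem (r - 1) (by omega) (fixedWord_pred hcan hr)
    rw [zero_dvd_iff] at this
    omega
  rcases Nat.eq_zero_or_pos n with rfl | hpos
  · exact dvd_zero _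
  · exact (height_dvd_returnGcd h0).trans (hmem n hpos hn)

theorem height_pos (hcan : θ.IsCanonical) (hr : 2 ≤ r) : 0 < θ.height :=
  Nat.pos_of_dvd_of_pos (height_dvd hcan hr (fixedWord_pred hcan hr)) (by omega)

/-- Inflation therefore preserves positions modulo the height: r^k q + i ≡ q + i. -/
theorem natCast_length_eq_one (hcan : θ.IsCanonical) (hr : 2 ≤ r) : (r : ZMod θ.height) = 1 := by
  have := (ZMod.natCast_eq_zero_iff _ _).2 (height_dvd hcan hr (fixedWord_pred hcan hr))
  rwa [Nat.cast_sub (by omega), Nat.cast_one, sub_eq_zero] at this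

theorem fixedWord_firstZero (hcan : θ.IsCanonical) (hprim : θ.IsPrimitive) (hr : 2 ≤ r)
    (a : Fin (N + 1)) : θ.fixedWord a (θ.firstZero a) = 0 := by
  obtain ⟨k, hk⟩ := hprim
  obtain ⟨n, hn, h⟩ := hk a 0
  exact Nat.sInf_mem (s := {n | θ.fixedWord a n = 0}) ⟨n, by
    rw [Set.mem_ofPred_eq, ← hcan.pow_eq_fixedWord hr hn, h]⟩

/-- Applying θ^z, with z the first zero of the letter at n, yields a zero at r^z n + z ≡ n + z. -/
theorem firstZero_fixedWord (hcan : θ.IsCanonical) (hprim : θ.IsPrimitive) (hr : 2 ≤ r)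
    (n : ℕ) : (θ.firstZero (θ.fixedWord 0 n) : ZMod θ.height) = -n := by
  set a := θ.fixedWord 0 n with ha
  set z := θ.firstZero a with hz
  have hzr : z < r ^ z := Nat.lt_pow_self (by omega)
  have hnr : n < r ^ n := Nat.lt_pow_self (by omega)
  have h1 : θ.pow (z + n) 0 (r ^ z * n + z) = 0 := by
    rw [pow_add_apply _ _ _ _ _ _ hzr, hcan.pow_eq_fixedWord hr hnr, ← ha,
      hcan.pow_eq_fixedWord hr hzr, hz, fixedWord_firstZero hcan hprim hr]
  rw [hcan.pow_eq_fixedWord hr (by rw [_root_.pow_add]; nlinarith)] at h1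
  have h2 := (ZMod.natCast_eq_zero_iff _ _).2 (height_dvd hcan hr h1)
  push_cast [natCast_length_eq_one hcan hr] at h2
  rw [one_pow, one_mul] at h2
  exact eq_neg_of_add_eq_zero_right h2

theorem firstZero_pow (hcan : θ.IsCanonical) (hprim : θ.IsPrimitive) (hr : 2 ≤ r)
    (a : Fin (N + 1)) {k i : ℕ} (hi : i < r ^ k) :
    (θ.firstZero (θ.pow k a i) : ZMod θ.height) = θ.firstZero a - i := by
  obtain ⟨K, hK⟩ := hprim
  obtain ⟨n, hn, rfl⟩ := hK 0 a
  rw [← pow_add_apply _ _ _ _ _ _ hi, hcan.pow_eq_fixedWord hr hn, hcan.pow_eq_fixedWord hr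
    (by rw [_root_.pow_add]; nlinarith), firstZero_fixedWord hcan ⟨K, hK⟩ hr,
    firstZero_fixedWord hcan ⟨K, hK⟩ hr]
  push_cast [natCast_length_eq_one hcan hr]
  ring

/-! ### Classes of two-letter words -/

theorem PairsPartition.class_unique (hpart : θ.PairsPartition) {C D : θ.PairClass}
    {w : Fin (N + 1) × Fin (N + 1)} (hC : w ∈ C.1) (hD : w ∈ D.1) : C = D := by
  by_contra hne
  exact Set.disjoint_left.1 (hpart.disjoint C.1 C.2 D.1 D.2 fun h => hne (Subtype.ext h)) hC hD

/-- Both words lie in the same P(p, j, k), which disjointness identifies with C. -/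
theorem PairsPartition.mem_class_congr (hpart : θ.PairsPartition) {a b : Fin (N + 1)}
    (hab : (θ.firstZero a : ZMod θ.height) = θ.firstZero b) {k j : ℕ} (hj : j + 1 < r ^ k)
    {C : θ.PairClass} (hC : (θ.pow k a j, θ.pow k a (j + 1)) ∈ C.1) :
    (θ.pow k b j, θ.pow k b (j + 1)) ∈ C.1 := by
  have hk : 0 < k := by
    rcases Nat.eq_zero_or_pos k with rfl | h
    · simp at hj
    · exact h
  let D : θ.PairClass := ⟨θ.pairSet (-(θ.firstZero a : ZMod θ.height)) j k, _, j, k, hk, hj, rfl⟩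
  have hD : (θ.pow k a j, θ.pow k a (j + 1)) ∈ D.1 := ⟨a, by simp [letterClass], rfl⟩
  rw [hpart.class_unique hC hD]
  exact ⟨b, by simp [letterClass, hab], rfl⟩

/-- The common value on P(p, j, k) is -p - (j + 1). Hence the choice of `last` does not matter
modulo the height. -/
theorem firstZero_snd_eq (hcan : θ.IsCanonical) (hprim : θ.IsPrimitive) (hr : 2 ≤ r)
    {C : θ.PairClass} {v w : Fin (N + 1) × Fin (N + 1)} (hv : v ∈ C.1) (hw : w ∈ C.1) :
    (θ.firstZero v.2 : ZMod θ.height) = θ.firstZero w.2 := by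
  obtain ⟨_, p, j, k, hk, hj, rfl⟩ := C
  obtain ⟨a, ha, rfl⟩ := hv
  obtain ⟨b, hb, rfl⟩ := hw
  have ha' : (θ.firstZero a : ZMod θ.height) = -p := ha
  have hb' : (θ.firstZero b : ZMod θ.height) = -p := hb
  simp only [firstZero_pow hcan hprim hr _ hj, ha', hb']

/-! ### Powers of the intermediate substitution -/

theorem intermediate_apply_zero (last : θ.PairClass → Fin (N + 1)) (b : θ.PairClass)
    (h : Fin r) (h0 : (h : ℕ) = 0) : θ.intermediate last b h = b := by
  rw [intermediate, dif_pos h0]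

theorem mem_intermediate_apply (last : θ.PairClass → Fin (N + 1)) (b : θ.PairClass)
    {i : ℕ} (hi : i + 1 < r) :
    (θ.pow 1 (last b) i, θ.pow 1 (last b) (i + 1)) ∈ (θ.intermediate last b ⟨i + 1, hi⟩).1 := by
  rw [intermediate, dif_neg (by simp)]
  rw [show θ.pow 1 (last b) i = _ from pow_one_apply θ (last b) ⟨i, by omega⟩,
    show θ.pow 1 (last b) (i + 1) = _ from pow_one_apply θ (last b) ⟨i + 1, hi⟩]
  exact (θ.exists_pairSet (last b) ⟨i + 1, hi⟩ ⟨i, by omega⟩ rfl).choose_spec.2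

/-- The letters of `φ ^ n (b)`, except the first one, are the classes of the two-letter subwords
of `θ ^ n (d)`, where `d` is the chosen last letter of `b`. -/
theorem mem_intermediate_pow (hcan : θ.IsCanonical) (hprim : θ.IsPrimitive) (hr : 2 ≤ r)
    (hpart : θ.PairsPartition) {last : θ.PairClass → Fin (N + 1)}
    (hlast : ∀ b : θ.PairClass, ∃ a, (a, last b) ∈ b.1) (b : θ.PairClass) (n : ℕ) {i : ℕ}
    (hi : i + 1 < r ^ n) :
    (θ.pow n (last b) i, θ.pow n (last b) (i + 1)) ∈
      ((θ.intermediate last).pow n b (i + 1)).1 := by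
  induction n generalizing i with
  | zero => simp at hi
  | succ n ih =>
    have hr0 : 0 < r := by omega
    have hqlt : (i + 1) / r < r ^ n := by
      rw [Nat.div_lt_iff_lt_mul hr0, ← pow_succ]; exact hi
    have hdm := Nat.div_add_mod (i + 1) r
    have hmod := Nat.mod_lt (i + 1) hr0
    rcases Nat.eq_zero_or_pos ((i + 1) % r) with h | h
    -- The word straddles two blocks; by canonical form it is already the word at q, q + 1 of
    -- θ^n(last b).
    · obtain ⟨q, hq⟩ : ∃ q, (i + 1) / r = q + 1 :=
        Nat.exists_eq_add_one_of_ne_zero fun h0 => by rw [h0, h] at hdm; omega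
      have hi1 : i = r * q + (r - 1) := by rw [hq, mul_add] at hdm; omega
      have hi2 : i / r = q := by
        rw [hi1, Nat.mul_add_div hr0, Nat.div_eq_of_lt (by omega), add_zero]
      have hi3 : i % r = r - 1 := by
        rw [hi1, Nat.mul_add_mod, Nat.mod_eq_of_lt (by omega)]
      have h1 := ih (i := q) (by omega)
      simp only [pow]
      rw [hq, hi2, hcan _ (Fin.ofNat r i) (Or.inr (by simp only [Fin.ofNat]; omega)),
        hcan _ (Fin.ofNat r (i + 1)) (Or.inl h), intermediate_apply_zero last _ _ h]
      exact h1
    · obtain ⟨s, hs⟩ : ∃ s, (i + 1) % r = s + 1 := ⟨(i + 1) % r - 1, by omega⟩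
      set q := (i + 1) / r with hq
      set c := (θ.intermediate last).pow n b q with hc
      -- Inside a block, φ uses θ(last c) in place of θ(θ^n(last b)_q); equal residues make the
      -- classes agree.
      have hcq : (θ.firstZero (last c) : ZMod θ.height) =
          θ.firstZero (θ.pow n (last b) q) := by
        rcases Nat.eq_zero_or_pos q with h0 | h0
        · rw [hc, h0, pow_apply_zero _ (intermediate_apply_zero last),
            pow_apply_zero _ hcan.apply_zero]
        · obtain ⟨t, ht⟩ : ∃ t, q = t + 1 := ⟨q - 1, by omega⟩
          obtain ⟨a, ha⟩ := hlast c
          have h1 := ih (i := t) (by omega)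
          rw [← ht] at h1
          exact firstZero_snd_eq hcan hprim hr ha h1
      have h1 := hpart.mem_class_congr hcq (by rw [pow_one]; omega)
        (mem_intermediate_apply last c (i := s) (by omega))
      have e1 : i = r ^ 1 * q + s := by rw [pow_one]; omega
      rw [← pow_add_apply _ _ _ _ _ _ (by rw [pow_one]; omega),
        ← pow_add_apply _ _ _ _ _ _ (by rw [pow_one]; omega), ← add_assoc, ← e1,
        add_comm 1 n] at h1
      convert h1 using 2
      simp only [pow]
      rw [← hq, ← hc, show Fin.ofNat r (i + 1) = ⟨s + 1, by omega⟩ from Fin.ext hs]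

theorem firstZero_last_intermediate_pow (hcan : θ.IsCanonical) (hprim : θ.IsPrimitive)
    (hr : 2 ≤ r) (hpart : θ.PairsPartition) {last : θ.PairClass → Fin (N + 1)}
    (hlast : ∀ b : θ.PairClass, ∃ a, (a, last b) ∈ b.1) (b : θ.PairClass) (n : ℕ) {i : ℕ}
    (hi : i < r ^ n) :
    (θ.firstZero (last ((θ.intermediate last).pow n b i)) : ZMod θ.height) =
      θ.firstZero (last b) - i := by
  rcases Nat.eq_zero_or_pos i with rfl | h
  · simp [pow_apply_zero _ (intermediate_apply_zero last)]
  · obtain ⟨j, rfl⟩ : ∃ j, i = j + 1 := ⟨i - 1, by omega⟩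
    obtain ⟨a, ha⟩ := hlast ((θ.intermediate last).pow n b (j + 1))
    have h1 := mem_intermediate_pow hcan hprim hr hpart hlast b n hi
    exact (firstZero_snd_eq hcan hprim hr ha h1).trans (firstZero_pow hcan hprim hr _ hi)

theorem firstZero_last_add (hcan : θ.IsCanonical) (hprim : θ.IsPrimitive)
    (hr : 2 ≤ r) (hpart : θ.PairsPartition) {last : θ.PairClass → Fin (N + 1)}
    (hlast : ∀ b : θ.PairClass, ∃ a, (a, last b) ∈ b.1) {y : ℤ → θ.PairClass}
    (hy : y ∈ (θ.intermediate last).space) (n : ℤ) (j : ℕ) :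
    (θ.firstZero (last (y (n + j))) : ZMod θ.height) = θ.firstZero (last (y n)) - j := by
  obtain ⟨b, k, q, hq, H⟩ := hy n (j + 1)
  have h0 := H 0 (by omega)
  rw [Nat.cast_zero, add_zero, add_zero] at h0
  rw [H j (by omega), h0, firstZero_last_intermediate_pow hcan hprim hr hpart hlast b k (by omega),
    firstZero_last_intermediate_pow hcan hprim hr hpart hlast b k (by omega)]
  push_cast; ring

theorem firstZero_last_periodic (hcan : θ.IsCanonical) (hprim : θ.IsPrimitive)
    (hr : 2 ≤ r) (hpart : θ.PairsPartition) {last : θ.PairClass → Fin (N + 1)}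
    (hlast : ∀ b : θ.PairClass, ∃ a, (a, last b) ∈ b.1) {y : ℤ → θ.PairClass}
    (hy : y ∈ (θ.intermediate last).space) (n q : ℤ) :
    (θ.firstZero (last (y (n + θ.height * q))) : ZMod θ.height) = θ.firstZero (last (y n)) := by
  have key : ∀ (n : ℤ) (q : ℕ), (θ.firstZero (last (y (n + θ.height * q))) : ZMod θ.height) =
      θ.firstZero (last (y n)) := fun n q => by
    have := firstZero_last_add hcan hprim hr hpart hlast hy n (θ.height * q)
    simpa using this
  obtain ⟨s, rfl | rfl⟩ := q.eq_nat_or_neg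
  · exact key n s
  · have := key (n + θ.height * -s) s
    rw [mul_neg, neg_add_cancel_right] at this
    rw [mul_neg, ← this]

instance : Finite θ.PairClass := inferInstanceAs (Finite {C // C ∈ θ.pairSets})

/-- A word of the class C is legal, so it occurs in θ^k(a) for some a and then in θ^(k+K)(last b)
for every b; thus C occurs in φ^(k+K)(b). -/
theorem isPrimitive_intermediate (hcan : θ.IsCanonical) (hprim : θ.IsPrimitive)
    (hr : 2 ≤ r) (hpart : θ.PairsPartition) {last : θ.PairClass → Fin (N + 1)}
    (hlast : ∀ b : θ.PairClass, ∃ a, (a, last b) ∈ b.1) : (θ.intermediate last).IsPrimitive := by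
  have hex : ∀ C : θ.PairClass, ∃ k, ∀ b, ∃ n < r ^ k, (θ.intermediate last).pow k b n = C := by
    intro C
    obtain ⟨w, hw⟩ := hpart.nonempty C.1 C.2
    obtain ⟨x, hx, i, h1, h2⟩ : w ∈ θ.legalPairs := by
      rw [← hpart.union]
      exact ⟨C.1, C.2, hw⟩
    obtain ⟨a, k, n, hn, H⟩ := hx i 2
    have e1 := H 0 (by omega)
    have e2 := H 1 (by omega)
    rw [Nat.cast_zero, add_zero, add_zero, h1] at e1
    rw [Nat.cast_one, h2] at e2
    obtain ⟨K, hK⟩ := id hprim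
    refine ⟨k + K, fun b => ?_⟩
    obtain ⟨s, hs, hsa⟩ := hK (last b) a
    have hlt : r ^ k * s + n + 1 < r ^ (k + K) := by
      rw [_root_.pow_add]; nlinarith
    refine ⟨_, hlt, ?_⟩
    have h3 := mem_intermediate_pow hcan hprim hr hpart hlast b (k + K) hlt
    have e3 : θ.pow (k + K) (last b) (r ^ k * s + n) = w.1 := by
      rw [pow_add_apply _ _ _ _ _ _ (by omega), hsa, e1]
    have e4 : θ.pow (k + K) (last b) (r ^ k * s + n + 1) = w.2 := by
      rw [add_assoc, pow_add_apply _ _ _ _ _ _ (by omega), hsa, e2]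
    rw [e3, e4] at h3
    exact hpart.class_unique h3 hw
  choose K hK using hex
  cases nonempty_fintype θ.PairClass
  -- One exponent serves all classes because φ^k(b) is a prefix of φ^l(b) for k ≤ l.
  refine ⟨Finset.univ.sup K, fun b C => ?_⟩
  obtain ⟨n, hn, h⟩ := hK C b
  have hle : K C ≤ Finset.univ.sup K := Finset.le_sup (Finset.mem_univ C)
  exact ⟨n, hn.trans_le (Nat.pow_le_pow_right (by omega) hle),
    (pow_of_le _ (intermediate_apply_zero last) hle b hn).trans h⟩

theorem intermediate_pow_congr (hcan : θ.IsCanonical) (hprim : θ.IsPrimitive)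
    (hr : 2 ≤ r) (hpart : θ.PairsPartition) {last : θ.PairClass → Fin (N + 1)}
    (hlast : ∀ b : θ.PairClass, ∃ a, (a, last b) ∈ b.1) (k : ℕ) (b c : θ.PairClass) (i : ℕ)
    (hbc : (θ.firstZero (last b) : ZMod θ.height) = θ.firstZero (last c)) (h0 : 0 < i)
    (hi : i < r ^ k) :
    (θ.intermediate last).pow k b i = (θ.intermediate last).pow k c i := by
  obtain ⟨j, rfl⟩ : ∃ j, i = j + 1 := ⟨i - 1, by omega⟩
  exact hpart.class_unique
    (hpart.mem_class_congr hbc hi (mem_intermediate_pow hcan hprim hr hpart hlast b k hi))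
    (mem_intermediate_pow hcan hprim hr hpart hlast c k hi)

end Classes

end Substitution

theorem mainTheorem7 {N r : ℕ} [NeZero r] (θ : Substitution (Fin (N + 1)) r)
    (hadm : θ.IsAdmissible) (hprim : θ.IsPrimitive) (hcan : θ.IsCanonical)
    (hfree : θ.IsCoincidenceFree) (hpart : θ.PairsPartition)
    (last : θ.PairClass → Fin (N + 1)) (hlast : ∀ b : θ.PairClass, ∃ a, (a, last b) ∈ b.1) :
    (∃ (Y : Type) (_ : TopologicalSpace Y) (S : Y ≃ₜ Y) (π : (θ.intermediate last).space → Y),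
      IsMaximalEquicontinuousFactor (θ.intermediate last).shift S π) ∧
    ∀ (Y : Type) [TopologicalSpace Y] (S : Y ≃ₜ Y) (π : (θ.intermediate last).space → Y),
      IsMaximalEquicontinuousFactor (θ.intermediate last).shift S π → IsAlmostOneToOne π := by
  have hr := Substitution.two_le_of_isAdmissible hadm hcan
  have hT := (θ.intermediate last).isMinimalSystem_shift
    (Substitution.isPrimitive_intermediate hcan hprim hr hpart hlast)
  have h1 := (θ.intermediate last).isAlmostOneToOne_rationalCoding hr hT
    (fun b => (θ.firstZero (last b) : ZMod θ.height)) (Substitution.height_pos hcan hr)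
    (fun y hy => Substitution.firstZero_last_periodic hcan hprim hr hpart hlast hy)
    (Substitution.intermediate_pow_congr hcan hprim hr hpart hlast)
  have := (θ.intermediate last).compactSpace_space
  have := hT.compactSpace_range_rationalCoding
  have hS := isEquicontinuousSystem_rationalShift (θ.intermediate last).shift
  have hπ := hT.isFactorMap_rationalCoding
  exact ⟨⟨_, _, _, _, hT.isMaximalEquicontinuousFactor hπ hS h1⟩,
    fun Y _ S π h => h.isAlmostOneToOne hπ hS h1⟩
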